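/- **Setting.** In the I/O-model with internal memory of size $M$ and blocks of size $B$ ($B\ge 1$, $M\ge 2B$), put $\mathrm{sort}(k)=\frac kB\log_{M/B}\frac kB$ when I/Os are counted and $\mathrm{sort}(k)=k\log_2 k$ when time is counted (with value $0$ for $k=0$). Costs are accounted for as follows: reading or writing $k$ consecutive elements costs $k/B$ I/Os and $k$ time; sorting $k$ elements, and likewise passing $k$ elements through a priority queue ($k$ insertions and $k$ deletions), costs $\mathrm{sort}(k)$ time, and $\mathrm{sort}(k)$ I/Os if $k>M$ and no I/Os if $k\le M$. The space of a run is the largest number of elements (nodes, arcs, requests) that are stored in its files and priority queues at the same time. **Nested sweeping.** The input is a reduced ordered BDD $f$ over variables $x_0,\dots,x_{n-1}$, given as the list of its nodes sorted by (level, index), together with a set $X$ of nested levels and, for each $x_j\in X$, a binary Boolean operator $\odot_j$ ($\vee$ for existential, $\wedge$ for universal quantification of $x_j$). 1. *Outer Apply*: $f$ is transposed, i.e. its nodes are split into arcs (including one arc into the root), which are sorted by target. 2. *Outer Reduce*: the levels of the transposed OBDD are processed bottom-up. The unreduced nodes $s$ of a level are reduced to $t'$ (a redundant node is replaced by its child,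 duplicates are merged), and for each parent $s$ of such a node the arc $s\to t'$ is put into the priority queue of the outer Reduce, or, if $s$ lies above the deepest nested level $x_j$ that is not yet processed, into the priority queue of the next inner Apply. On level $x_j$ itself, the arc $s\to t'$ to a reduced node $t'$ of that level becomes the request $s\to \mathrm{low}(t')\odot_j\mathrm{high}(t')$; all other requests preserve $t'$. 3. *Inner Apply*: after level $x_j$ all these requests are processed by a top-down product construction on the nodes reduced so far, where deferred requests are kept in a priority queue and equal requests are merged; it outputs an unreduced transposed OBDD. 4. *Inner Reduce*: this OBDD is reduced bottom-up with a priority queue. Arcs $s\to t''$ with $s$ below $x_j$ stay in this sweep; with $x_i$ the next nested level above $x_j$, those with $s$ above $x_j$ but not above $x_i$ (or if there is no $x_i$) are returned to the outer Reduce; the others become preserving requests for the next inner Apply. The result replaces all nodes reduced so far, and the outer Reduce continues above $x_j$. The output is the BDD that has been accumulated when the outer Reduce has processed all levels. **Corollary.** Nested sweeping uses $\Omega(N+T)$ space and $\Omega(\mathrm{sort}(N+T))$ time and I/Os, where $N$ and $T$ are the numbers of nodes of the input and of the output. That is, there is a constant $c>0$ such that for all $M,B$ with $B\ge1$ and $M\ge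 2B$, all $n$, all sets $X$ of nested levels with operators $\odot_j$, and every reduced ordered BDD $f$ over $x_0,\dots,x_{n-1}$, the run of nested sweeping on $f$ uses at least $c\,(N+T)$ space, at least $c\,(N+T)\log_2(N+T)$ time, and at least $c\,\frac{N+T}{B}\log_{M/B}\frac{N+T}{B}$ I/Os. -/

import Mathlib

namespace NestedSweeping

/-! ## Ordered BDDs as levelised node files and arc files -/

/-- Unique identifier of a node: the level (index of its variable) and an index on that level. -/
abbrev Uid := ℕ × ℕ

/-- A pointer: to one of the two terminals, or to an internal node. -/
inductive Ptr where
  | leaf (b : Bool)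
  | node (u : Uid)
  deriving DecidableEq

/-- An internal node: its unique identifier, its low child and its high child. -/
structure Node where
  uid : Uid
  low : Ptr
  high : Ptr
  deriving DecidableEq

/-- The high child for `d = true`, the low child for `d = false`. -/
def Node.child (v : Node) (d : Bool) : Ptr := if d then v.high else v.low

/-- A singly-rooted decision diagram: a list of nodes and its root. -/
structure Bdd where
  nodes : List Node
  root : Ptr

/-- The size of a BDD is the number of its internal nodes. -/
def Bdd.size (f : Bdd) : ℕ := f.nodes.length

/-- `f` is a reduced ordered BDD over the variables `x_0, …, x_{n-1}` (in this order), stored as the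
list of its nodes, sorted lexicographically by unique identifier. -/
structure Bdd.IsROBDD (n : ℕ) (f : Bdd) : Prop where
  /-- the nodes are sorted by their unique identifiers, which are pairwise distinct -/
  sorted : f.nodes.Pairwise fun v w =>
    v.uid.1 < w.uid.1 ∨ (v.uid.1 = w.uid.1 ∧ v.uid.2 < w.uid.2)
  /-- there are `n` variables -/
  level_lt : ∀ v ∈ f.nodes, v.uid.1 < n
  /-- children are nodes of the BDD and lie on deeper levels -/
  child_mem : ∀ v ∈ f.nodes, ∀ d u, v.child d = .node u →
    v.uid.1 < u.1 ∧ ∃ w ∈ f.nodes, w.uid = u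
  root_mem : ∀ u, f.root = .node u → ∃ w ∈ f.nodes, w.uid = u
  /-- every node is reachable: it is the root or the child of some node -/
  reachable : ∀ w ∈ f.nodes, f.root = .node w.uid ∨ ∃ v ∈ f.nodes, ∃ d, v.child d = .node w.uid
  /-- no node is redundant -/
  not_redundant : ∀ v ∈ f.nodes, v.low ≠ v.high
  /-- no node is a duplicate of another -/
  not_duplicate : ∀ v ∈ f.nodes, ∀ w ∈ f.nodes,
    v.uid.1 = w.uid.1 → v.low = w.low → v.high = w.high → v = w

/-- An arc from the node `src` to `tgt`; `dir` tells whether it is a high arc. The source `none` is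
used for the arc that leads into the root. -/
structure Arc where
  src : Option Uid
  dir : Bool
  tgt : Ptr
  deriving DecidableEq

/-- The source of the arc is a node on level `l`. -/
def Arc.from (a : Arc) (l : ℕ) : Bool :=
  match a.src with
  | some u => u.1 = l
  | none => false

/-- The target of the arc is a terminal. -/
def Arc.toLeaf (a : Arc) : Bool :=
  match a.tgt with
  | .leaf _ => true
  | .node _ => false

/-- Sorting key of a pointer: nodes by unique identifier, then terminals. -/
def Ptr.key : Ptr → List ℕ
  | .node u => [0, u.1, u.2]
  | .leaf b => [1, b.toNat, 0]

/-- Sorting of a list with respect to a key. -/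
def sortOn {α : Type} (key : α → List ℕ) (xs : List α) : List α :=
  xs.mergeSort fun a b => decide (key a ≤ key b)

/-! ## Accounting in the I/O-model -/

/-- `sort(k) = (k/B) log_{M/B}(k/B)`, for I/Os. -/
noncomputable def sortIos (M B k : ℕ) : ℝ :=
  (k : ℝ) / B * Real.logb ((M : ℝ) / B) ((k : ℝ) / B)

/-- `sort(k) = k log k`, for time. -/
noncomputable def sortTime (k : ℕ) : ℝ := (k : ℝ) * Real.logb 2 k

/-- What a run is charged for. Sorting is by an external sorter and priority queues are external ones,
so that both are charged `sort(k)` for `k` elements. -/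
inductive Event where
  /-- `k` elements of a file are read or written consecutively -/
  | scan (k : ℕ)
  /-- `k` elements are sorted -/
  | sort (k : ℕ)
  /-- `k` elements pass through a priority queue (`k` insertions and `k` deletions) -/
  | queue (k : ℕ)
  /-- at this moment `k` elements are stored in files and priority queues -/
  | live (k : ℕ)

/-- The I/Os of an event: a scan costs `k/B`; sorting and priority queues work for free as long as
the `k` elements fit into the internal memory, and otherwise cost `sort(k)`. -/
noncomputable def Event.ios (M B : ℕ) : Event → ℝ
  | .scan k => (k : ℝ) / B
  | .sort k => if k ≤ M then 0 else sortIos M B k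
  | .queue k => if k ≤ M then 0 else sortIos M B k
  | .live _ => 0

/-- The time of an event. -/
noncomputable def Event.time : Event → ℝ
  | .scan k => k
  | .sort k => sortTime k
  | .queue k => sortTime k
  | .live _ => 0

/-- The number of elements stored at an event. -/
def Event.space : Event → ℕ
  | .live k => k
  | _ => 0

/-- I/Os of a run. -/
noncomputable def ios (M B : ℕ) (tr : List Event) : ℝ := (tr.map (Event.ios M B)).sum

/-- Time of a run. -/
noncomputable def time (tr : List Event) : ℝ := (tr.map Event.time).sum

/-- Space of a run: the largest number of elements that are stored at the same time. -/
def space (tr : List Event) : ℕ := (tr.map Event.space).foldr max 0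

/-! ## Reducing one level

Used by both the outer and the inner Reduce sweep. -/

/-- The child in direction `d` of the unreduced node `s`, given the arcs that leave its level. -/
def childOf (arcs : List Arc) (s : Uid) (d : Bool) : Ptr :=
  match arcs.find? fun a => a.src = some s ∧ a.dir = d with
  | some a => a.tgt
  | none => .leaf false

/-- The result of reducing one level: the number of unreduced nodes, the reduced nodes, and the arcs
`s → t'` into what the nodes of this level have been reduced to. -/
structure LevelResult where
  width : ℕ
  nodes : List Node
  fwd : List Arc

/-- Reduce level `l` of the unreduced (transposed) OBDD `file`, where `pq` contains the arcs
`s → t'` from unreduced nodes `s` to already reduced nodes `t'`. Arcs to terminals are read from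
`file`. A redundant node is replaced by its child; nodes with the same children are merged. -/
def reduceLevel (file pq : List Arc) (l : ℕ) : LevelResult :=
  let arcs := pq.filter (fun a => a.from l) ++ file.filter (fun a => a.from l && a.toLeaf)
  let srcs := (arcs.filterMap Arc.src).dedup
  let kids := fun s => (childOf arcs s false, childOf arcs s true)
  let keys := (sortOn (fun p => p.1.key ++ p.2.key)
    ((srcs.map kids).filter fun p => p.1 ≠ p.2)).dedup
  let reduced := fun s =>
    if (kids s).1 = (kids s).2 then (kids s).1 else Ptr.node (l, keys.idxOf (kids s))
  { width := srcs.length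
    nodes := keys.mapIdx fun i p => ⟨(l, i), p.1, p.2⟩
    fwd := file.filterMap fun a =>
      match a.tgt with
      | .node u => if u.1 = l then some ⟨a.src, a.dir, reduced u⟩ else none
      | .leaf _ => none }

/-! ## Requests of the inner sweeps -/

/-- Target of a request for an inner Apply sweep: preserve the subgraph of `t`, or combine the two
subgraphs of `l` and `h` with the operator of this sweep. -/
inductive Req where
  | keep (t : Ptr)
  | comb (l h : Ptr)
  deriving DecidableEq

/-- A request `src → req`. -/
structure Request where
  src : Option Uid
  dir : Bool
  req : Req

/-- Resolve `op a t` where `a` is a terminal, for `g = op a`. `r` is the unresolved request. -/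
def resolveUnary (g : Bool → Bool) (t : Ptr) (r : Req) : Req :=
  match t with
  | .leaf b => .keep (.leaf (g b))
  | .node u =>
    if g false = g true then .keep (.leaf (g false))
    else if g true then .keep (.node u)
    else r

/-- Resolve a request as far as terminals allow it: short-circuiting and neutral terminals. -/
def Req.resolve (op : Bool → Bool → Bool) : Req → Req
  | .keep t => .keep t
  | .comb (.leaf a) t => resolveUnary (op a) t (.comb (.leaf a) t)
  | .comb t (.leaf b) => resolveUnary (fun a => op a b) t (.comb t (.leaf b))
  | .comb (.node u) (.node v) => .comb (.node u) (.node v)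

/-- The level on which a request has to be processed; `none` if there are only terminals. -/
def Req.level : Req → Option ℕ
  | .keep (.leaf _) => none
  | .keep (.node u) => some u.1
  | .comb (.leaf _) (.leaf _) => none
  | .comb (.leaf _) (.node v) => some v.1
  | .comb (.node u) (.leaf _) => some u.1
  | .comb (.node u) (.node v) => some (min u.1 v.1)

/-- Sorting key of a request target. -/
def Req.key : Req → List ℕ
  | .keep t => 0 :: t.key
  | .comb l h => 1 :: (l.key ++ h.key)

/-- Follow direction `d` from `t`, if `t` is on level `l`; `G` is the file of reduced nodes. -/
def follow (G : List Node) (l : ℕ) (d : Bool) : Ptr → Ptr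
  | .leaf b => .leaf b
  | .node u =>
    if u.1 = l then
      match G.find? fun v => v.uid = u with
      | some v => v.child d
      | none => .leaf false
    else .node u

/-- Follow direction `d` on level `l` in all parts of the request. -/
def Req.follow (G : List Node) (l : ℕ) (d : Bool) : Req → Req
  | .keep t => .keep (NestedSweeping.follow G l d t)
  | .comb t t' => .comb (NestedSweeping.follow G l d t) (NestedSweeping.follow G l d t')

/-- Requests that have been resolved to a terminal become arcs to this terminal. -/
def Request.leafArc? (e : Request) : Option Arc :=
  match e.req with
  | .keep (.leaf b) => some ⟨e.src, e.dir, .leaf b⟩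
  | _ => none

/-! ## Inner Apply sweep -/

/-- State of an inner Apply sweep: its priority queue, the number of elements that have been put into
it so far, the output file, and the events so far. -/
structure ApplyState where
  pq : List Request
  pushed : ℕ
  file : List Arc
  trace : List Event

/-- Process level `l`: equal requests are merged into one new node each, whose arcs are either
resolved to terminals or deferred to a deeper level. `G` is the file of reduced nodes, and `base` is
the number of elements stored outside of this sweep. -/
def applyLevel (op : Bool → Bool → Bool) (G : List Node) (base : ℕ) (st : ApplyState) (l : ℕ) :
    ApplyState :=
  let here := st.pq.filter fun e => e.req.level = some l
  let rest := st.pq.filter fun e => e.req.level ≠ some l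
  let reqs := (sortOn Req.key (here.map Request.req)).dedup
  let up := here.map fun e => Arc.mk e.src e.dir (.node (l, reqs.idxOf e.req))
  let next := (reqs.mapIdx fun i r => [false, true].map fun d =>
    Request.mk (some (l, i)) d ((r.follow G l d).resolve op)).flatten
  let defer := next.filter fun e => e.leafArc?.isNone
  let pq := rest ++ defer
  let file := st.file ++ up ++ next.filterMap Request.leafArc?
  { pq := pq
    pushed := st.pushed + defer.length
    file := file
    trace := st.trace ++ [.live (base + pq.length + file.length)] }

/-- The inner Apply sweep below level `j`, started from the requests `roots`. -/
def innerApply (n j : ℕ) (op : Bool → Bool → Bool) (G : List Node) (base : ℕ)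
    (roots : List Request) : ApplyState :=
  let roots' := roots.map fun e => { e with req := e.req.resolve op }
  let st := (List.range' (j + 1) (n - (j + 1))).foldl (applyLevel op G base)
    { pq := roots'.filter fun e => e.leafArc?.isNone
      pushed := roots.length
      file := roots'.filterMap Request.leafArc?
      trace := [.live (base + roots.length)] }
  { st with trace := st.trace ++ [.queue st.pushed, .scan G.length, .scan st.file.length] }

/-! ## Inner Reduce sweep -/

/-- The largest level strictly less than `m` that needs a nested sweep. -/
def nextNested (nest : ℕ → Option (Bool → Bool → Bool)) : ℕ → Option ℕ
  | 0 => none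
  | m + 1 => if (nest m).isSome then some m else nextNested nest m

/-- There is a next nested level `x`, and the source `s` lies above it. -/
def crosses (x : Option ℕ) (s : Option Uid) : Bool :=
  match x, s with
  | none, _ => false
  | some _, none => true
  | some x, some u => u.1 < x

/-- The source lies below level `j`. -/
def isBelow (j : ℕ) (s : Option Uid) : Bool :=
  match s with
  | none => false
  | some u => j < u.1

/-- State of an inner Reduce sweep: its priority queue and the number of elements that have been put
into it so far, the arcs given to the priority queue of the outer Reduce sweep, the requests for the
next inner Apply sweep, the reduced nodes, and the events so far. -/
structure InnerState where
  pq : List Arc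
  pushed : ℕ
  toOuter : List Arc
  toNext : List Request
  nodes : List Node
  trace : List Event

/-- Distribute the arcs `s → t''`: within the sweep if `s` is below level `j`, to the outer Reduce
sweep if `s` is not above the next nested level, to the next inner Apply sweep otherwise. -/
def InnerState.distribute (j : ℕ) (next : Option ℕ) (st : InnerState) (as : List Arc) :
    InnerState :=
  let within := as.filter fun a => isBelow j a.src
  let out := as.filter fun a => !isBelow j a.src
  { st with
    pq := st.pq ++ within
    pushed := st.pushed + within.length
    toOuter := st.toOuter ++ out.filter fun a => !crosses next a.src
    toNext := st.toNext ++ (out.filter fun a => crosses next a.src).map fun a =>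
      Request.mk a.src a.dir (.keep a.tgt) }

/-- Process level `l` in the inner Reduce sweep. The two sorts bring the nodes of the level into the
order of their children and back. -/
def innerReduceLevel (file : List Arc) (j : ℕ) (next : Option ℕ) (base : ℕ) (st : InnerState)
    (l : ℕ) : InnerState :=
  let r := reduceLevel file st.pq l
  let st' := InnerState.distribute j next
    { st with
      pq := st.pq.filter fun a => !a.from l
      nodes := r.nodes ++ st.nodes } r.fwd
  { st' with
    trace := st.trace ++ [.sort r.width, .sort r.width,
      .live (base + file.length + st'.pq.length + st'.toOuter.length + st'.toNext.length
        + st'.nodes.length)] }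

/-- The inner Reduce sweep below level `j` of the unreduced OBDD `file`. -/
def innerReduce (n j : ℕ) (next : Option ℕ) (base : ℕ) (file : List Arc) : InnerState :=
  let init := InnerState.distribute j next ⟨[], 0, [], [], [], []⟩
    (file.filter fun a => a.toLeaf && !isBelow j a.src)
  let st := (List.range' (j + 1) (n - (j + 1))).reverse.foldl
    (innerReduceLevel file j next base) init
  { st with
    trace := st.trace ++ [.scan file.length, .queue st.pushed, .scan st.nodes.length] }

/-! ## Outer sweeps -/

/-- Outer Apply sweep: transpose `f` by splitting its nodes into arcs (together with the arc into the
root) and sorting these by target. -/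
def outerApply (f : Bdd) : List Arc :=
  sortOn (fun a => a.tgt.key) (⟨none, false, f.root⟩ ::
    f.nodes.flatMap fun v => [⟨some v.uid, false, v.low⟩, ⟨some v.uid, true, v.high⟩])

/-- Events of the outer Apply sweep. -/
def outerApplyTrace (f : Bdd) : List Event :=
  [.scan f.size, .sort (outerApply f).length, .scan (outerApply f).length,
    .live (outerApply f).length]

/-- State of the outer Reduce sweep: its priority queue and the number of elements that have been put
into it so far, the requests for the next inner Apply sweep, the file of reduced nodes, and the
events so far. -/
structure OuterState where
  pq : List Arc
  pushed : ℕ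
  requests : List Request
  nodes : List Node
  trace : List Event

/-- The request for an arc `s → t'` into level `l`. If `l` is nested and `t'` is one of its (reduced)
nodes, then the two children of `t'` have to be combined; otherwise `t'` is preserved. -/
def toRequest (nested : Bool) (levelNodes : List Node) (a : Arc) : Request :=
  let r : Req :=
    if nested then
      match levelNodes.find? fun v => Ptr.node v.uid = a.tgt with
      | some v => .comb v.low v.high
      | none => .keep a.tgt
    else .keep a.tgt
  ⟨a.src, a.dir, r⟩

/-- Process level `l` in the outer Reduce sweep, without the inner sweeps. -/
def outerReduceLevel (nest : ℕ → Option (Bool → Bool → Bool)) (file : List Arc) (st : OuterState)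
    (l : ℕ) : OuterState :=
  let next := nextNested nest (l + 1)
  let r := reduceLevel file st.pq l
  let stay := r.fwd.filter fun a => !crosses next a.src
  let req := (r.fwd.filter fun a => crosses next a.src).map (toRequest (nest l).isSome r.nodes)
  let pq := (st.pq.filter fun a => !a.from l) ++ stay
  let requests := st.requests ++ req
  let nodes := r.nodes ++ st.nodes
  { pq := pq
    pushed := st.pushed + stay.length
    requests := requests
    nodes := nodes
    trace := st.trace ++ [.sort r.width, .sort r.width, .scan r.nodes.length,
      .live (file.length + pq.length + requests.length + nodes.length)] }

/-- The inner Apply and the inner Reduce sweep for the nested level `j`. The result replaces the whole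
file of reduced nodes. -/
def innerSweeps (n : ℕ) (nest : ℕ → Option (Bool → Bool → Bool)) (op : Bool → Bool → Bool)
    (file : List Arc) (j : ℕ) (st : OuterState) : OuterState :=
  let base := file.length + st.pq.length + st.nodes.length
  let ap := innerApply n j op st.nodes base st.requests
  let re := innerReduce n j (nextNested nest j) base ap.file
  { pq := st.pq ++ re.toOuter
    pushed := st.pushed + re.toOuter.length
    requests := re.toNext
    nodes := re.nodes
    trace := st.trace ++ ap.trace ++ re.trace }

/-- Process level `l` in the outer Reduce sweep, followed by the inner sweeps if `l` is nested. -/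
def outerStep (n : ℕ) (nest : ℕ → Option (Bool → Bool → Bool)) (file : List Arc) (st : OuterState)
    (l : ℕ) : OuterState :=
  let st' := outerReduceLevel nest file st l
  match nest l with
  | some op => innerSweeps n nest op file l st'
  | none => st'

/-- Result of a run: the output and the events. -/
structure Run where
  output : Bdd
  trace : List Event

/-- Nested sweeping on the BDD `f` over `x_0, …, x_{n-1}`: for every level `j` with
`nest j = some op`, from the deepest one to the root, the low and the high subgraph of each node on
level `j` are combined with `op`. With `or` on the levels in `X` this is existential quantification of
the variables in `X`, with `and` universal quantification. -/
def nestedSweep (n : ℕ) (nest : ℕ → Option (Bool → Bool → Bool)) (f : Bdd) : Run :=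
  let file := outerApply f
  let st := (List.range n).reverse.foldl (outerStep n nest file) ⟨[], 0, [], [], []⟩
  let rootArcs := (st.pq ++ file.filter Arc.toLeaf).filter fun a => a.src = none
  { output :=
      { nodes := st.nodes
        root := match rootArcs with
          | a :: _ => a.tgt
          | [] => .leaf false }
    trace := outerApplyTrace f ++ st.trace ++
      [.scan file.length, .queue st.pushed, .live (file.length + st.nodes.length)] }

end NestedSweeping

/-! Let `N` and `T` be the sizes of input and output. Space is immediate: at the end the transposed
input (`2N + 1` arcs) and the `T` output nodes are stored together.

For time and I/Os, the output is charged to two events. The outer Apply sorts `2N + 1` arcs, and the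
last inner Apply passes some `k` elements through its priority queue. An inner sweep replaces the
whole file of reduced nodes, so an output node was either added by the outer Reduce or is one of the
`t` nodes written by the last inner Reduce. The former inject, level by level, into the sources of
the input arcs, hence number at most `2N + 1`. The latter inject into the sources of the inner
Apply's output: sources of the initial requests, or new nodes, each using up an element of the
queue. Hence `t ≤ 2k` (`applyInv_innerApply`, `reduceInv_innerReduce`), and `T ≤ 2N + 1 + 2k`
(`exists_charge_nestedSweep`).

With `m = max (2N + 1) k` this gives `N + T ≤ 4m`, and `m` elements are sorted or queued. Passing
from `m` to `N + T` changes a logarithm to base at least 2 by at most 2; this linear error is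
absorbed by the scans of the input, of its arcs and of the `t` nodes. For I/Os, the same scans pay
when `m ≤ M` and sorting is free. -/

namespace NestedSweeping

/-! ## Sources of arcs and requests -/

/-- Every source that occurs in `as` is an element of `S`. -/
def SrcsIn (S : Finset Uid) (as : List Arc) : Prop :=
  ∀ a ∈ as, ∀ u, a.src = some u → u ∈ S

/-- Every source of a request in `rs` is an element of `S`. -/
def ReqSrcsIn (S : Finset Uid) (rs : List Request) : Prop :=
  ∀ e ∈ rs, ∀ u, e.src = some u → u ∈ S

/-- The set of all sources of the arcs of a file. -/
def srcSet (file : List Arc) : Finset Uid := (file.filterMap Arc.src).toFinset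

/-- The number of elements of `S` on level `l`. -/
def levelCard (S : Finset Uid) (l : ℕ) : ℕ := (S.filter fun u => u.1 = l).card

theorem srcsIn_srcSet (file : List Arc) : SrcsIn (srcSet file) file := by
  intro a ha u hu
  simp only [srcSet, List.mem_toFinset, List.mem_filterMap]
  exact ⟨a, ha, hu⟩

theorem card_srcSet_le (file : List Arc) : (srcSet file).card ≤ file.length :=
  (List.toFinset_card_le _).trans (List.length_filterMap_le _ _)

theorem SrcsIn.of_subset {S : Finset Uid} {as bs : List Arc} (h : SrcsIn S as)
    (hb : ∀ b ∈ bs, b ∈ as) : SrcsIn S bs :=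
  fun b hb' => h b (hb b hb')

theorem SrcsIn.append {S : Finset Uid} {as bs : List Arc} (ha : SrcsIn S as) (hb : SrcsIn S bs) :
    SrcsIn S (as ++ bs) := by
  intro a h
  rcases List.mem_append.1 h with h | h
  · exact ha a h
  · exact hb a h

theorem ReqSrcsIn.append {S : Finset Uid} {as bs : List Request} (ha : ReqSrcsIn S as)
    (hb : ReqSrcsIn S bs) : ReqSrcsIn S (as ++ bs) := by
  intro a h
  rcases List.mem_append.1 h with h | h
  · exact ha a h
  · exact hb a h

/-- Distinct levels are disjoint fibres of `Prod.fst`, so bounds per level add up to one global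
bound. -/
theorem sum_levelCard_le (S : Finset Uid) {L : List ℕ} (hL : L.Nodup) :
    (L.map (levelCard S)).sum ≤ S.card := by
  rw [← List.sum_toFinset _ hL]
  exact (Finset.sum_card_fiberwise_eq_card_filter S L.toFinset Prod.fst).le.trans
    (Finset.card_filter_le _ _)

theorem length_sortOn {α : Type} (key : α → List ℕ) (xs : List α) :
    (sortOn key xs).length = xs.length := by
  simp [sortOn]

/-! ## Reducing one level -/

theorem length_nodes_reduceLevel_le (file pq : List Arc) (l : ℕ) :
    (reduceLevel file pq l).nodes.length ≤ (reduceLevel file pq l).width := by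
  simp only [reduceLevel, List.length_mapIdx]
  refine (List.dedup_sublist _).length_le.trans ?_
  rw [length_sortOn]
  exact (List.length_filter_le _ _).trans (by rw [List.length_map])

/-- An unreduced node is only seen through the arcs leaving it, and duplicates among their sources
are removed. Tracking sources therefore suffices to count nodes. -/
theorem width_reduceLevel_le {S : Finset Uid} {file pq : List Arc} (hf : SrcsIn S file)
    (hp : SrcsIn S pq) (l : ℕ) : (reduceLevel file pq l).width ≤ levelCard S l := by
  simp only [reduceLevel]
  rw [← List.toFinset_card_of_nodup (List.nodup_dedup _)]
  refine Finset.card_le_card fun u hu => ?_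
  simp only [List.mem_toFinset, List.mem_dedup, List.mem_filterMap, List.mem_append,
    List.mem_filter, Bool.and_eq_true] at hu
  obtain ⟨a, ha, hau⟩ := hu
  have hfrom : a.from l = true := by
    rcases ha with ha | ha
    · exact ha.2
    · exact ha.2.1
  rw [Finset.mem_filter]
  refine ⟨?_, by simpa [Arc.from, hau] using hfrom⟩
  rcases ha with ha | ha
  · exact hp a ha.1 u hau
  · exact hf a ha.1 u hau

theorem length_nodes_reduceLevel_le_levelCard {S : Finset Uid} {file pq : List Arc}
    (hf : SrcsIn S file) (hp : SrcsIn S pq) (l : ℕ) :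
    (reduceLevel file pq l).nodes.length ≤ levelCard S l :=
  (length_nodes_reduceLevel_le file pq l).trans (width_reduceLevel_le hf hp l)

theorem srcsIn_fwd_reduceLevel {S : Finset Uid} {file : List Arc} (hf : SrcsIn S file)
    (pq : List Arc) (l : ℕ) : SrcsIn S (reduceLevel file pq l).fwd := by
  intro a ha u hu
  simp only [reduceLevel, List.mem_filterMap] at ha
  obtain ⟨b, hb, hba⟩ := ha
  refine hf b hb u ?_
  split at hba
  · split at hba
    · cases hba
      exact hu
    · cases hba
  · cases hba

/-! ## Inner Apply sweep -/

/-- Throughout an inner Apply sweep with `R` initial requests, the set `F` of sources seen so far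
consists of sources of initial requests, which are in `S`, and of new nodes below level `j`, each of
which accounts for an element that has left the priority queue. -/
structure ApplyInv (S : Finset Uid) (j R : ℕ) (F : Finset Uid) (st : ApplyState) : Prop where
  file : SrcsIn F st.file
  pq : ReqSrcsIn F st.pq
  origin : ∀ u ∈ F, u ∈ S ∨ j < u.1
  card : F.card + st.pq.length ≤ st.pushed + R
  initial : R ≤ st.pushed

theorem Request.src_of_mem_leafArc? {e : Request} {a : Arc} (h : e.leafArc? = some a) :
    a.src = e.src := by
  unfold Request.leafArc? at h
  split at h
  · cases h
    rfl
  · cases h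

theorem ReqSrcsIn.leafArcs {S : Finset Uid} {rs : List Request} (h : ReqSrcsIn S rs) :
    SrcsIn S (rs.filterMap Request.leafArc?) := by
  intro a ha u hu
  obtain ⟨e, he, hea⟩ := List.mem_filterMap.1 ha
  exact h e he u (by rw [← Request.src_of_mem_leafArc? hea, hu])

theorem ReqSrcsIn.filter {S : Finset Uid} {rs : List Request} (h : ReqSrcsIn S rs)
    (p : Request → Bool) : ReqSrcsIn S (rs.filter p) :=
  fun e he => h e (List.mem_of_mem_filter he)

theorem ReqSrcsIn.mono {S F : Finset Uid} {rs : List Request} (h : ReqSrcsIn S rs) (hF : S ⊆ F) :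
    ReqSrcsIn F rs :=
  fun e he u hu => hF (h e he u hu)

theorem SrcsIn.mono {S F : Finset Uid} {as : List Arc} (h : SrcsIn S as) (hF : S ⊆ F) :
    SrcsIn F as :=
  fun e he u hu => hF (h e he u hu)

/-- The potential `F.card + st.pq.length - st.pushed` does not increase: each new node merges at
least one request that leaves the queue, and each deferred request is counted in both `pq` and
`pushed`. -/
theorem ApplyInv.step {S : Finset Uid} {j R : ℕ} {F : Finset Uid} {st : ApplyState}
    (h : ApplyInv S j R F st) (op : Bool → Bool → Bool) (G : List Node) (base : ℕ) {l : ℕ}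
    (hl : j < l) : ∃ F', ApplyInv S j R F' (applyLevel op G base st l) := by
  set here := st.pq.filter fun e => e.req.level = some l with hhere
  set reqs := (sortOn Req.key (here.map Request.req)).dedup with hreqs
  set new : Finset Uid := (Finset.range reqs.length).image fun i => (l, i) with hnew
  set next := (reqs.mapIdx fun i r => [false, true].map fun d =>
    Request.mk (some (l, i)) d ((r.follow G l d).resolve op)).flatten with hnext
  have hsplit : (st.pq.filter fun e => e.req.level ≠ some l).length + here.length
      = st.pq.length := by
    have := List.length_eq_length_filter_add (l := st.pq) fun e => decide (e.req.level = some l)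
    simp only [hhere, ne_eq, decide_not]
    omega
  have hle : reqs.length ≤ here.length := by
    refine (List.dedup_sublist _).length_le.trans ?_
    rw [length_sortOn, List.length_map]
  have hcard : (F ∪ new).card ≤ F.card + reqs.length := by
    refine (Finset.card_union_le _ _).trans (Nat.add_le_add_left ?_ _)
    exact Finset.card_image_le.trans (by simp)
  have hsrc : ReqSrcsIn (F ∪ new) next := by
    intro e he u hu
    obtain ⟨es, hes, hees⟩ := List.mem_flatten.1 he
    obtain ⟨i, hi, rfl⟩ := List.mem_mapIdx.1 hes
    obtain ⟨d, -, rfl⟩ := List.mem_map.1 hees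
    cases hu
    exact Finset.mem_union_right _ (Finset.mem_image.2 ⟨i, Finset.mem_range.2 hi, rfl⟩)
  have hF : F ⊆ F ∪ new := Finset.subset_union_left
  refine ⟨F ∪ new, ?_, ?_, ?_, ?_, ?_⟩
  · refine ((h.file.mono hF).append ?_).append hsrc.leafArcs
    intro a ha u hu
    obtain ⟨e, he, rfl⟩ := List.mem_map.1 ha
    exact hF (h.pq e (List.mem_of_mem_filter he) u hu)
  · exact ((h.pq.filter _).mono hF).append (hsrc.filter _)
  · intro u hu
    rcases Finset.mem_union.1 hu with hu | hu
    · exact h.origin u hu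
    · obtain ⟨i, -, rfl⟩ := Finset.mem_image.1 hu
      exact Or.inr hl
  · change (F ∪ new).card + (_ ++ next.filter _).length ≤ st.pushed + (next.filter _).length + R
    rw [List.length_append]
    have := h.card
    omega
  · exact h.initial.trans (Nat.le_add_right _ _)

theorem ApplyInv.foldl {S : Finset Uid} {j R : ℕ} (op : Bool → Bool → Bool) (G : List Node)
    (base : ℕ) (L : List ℕ) (hL : ∀ l ∈ L, j < l) {F : Finset Uid} {st : ApplyState}
    (h : ApplyInv S j R F st) : ∃ F', ApplyInv S j R F' (L.foldl (applyLevel op G base) st) := by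
  induction L generalizing F st with
  | nil => exact ⟨F, h⟩
  | cons l L ih =>
    obtain ⟨F', h'⟩ := h.step op G base (hL l List.mem_cons_self)
    exact ih (fun l' hl' => hL l' (List.mem_cons_of_mem _ hl')) h'

theorem applyInv_innerApply {S : Finset Uid} {roots : List Request} (h : ReqSrcsIn S roots)
    (n j : ℕ) (op : Bool → Bool → Bool) (G : List Node) (base : ℕ) :
    ∃ F, ApplyInv S j roots.length F (innerApply n j op G base roots) := by
  set roots' := roots.map fun e => { e with req := e.req.resolve op } with hroots'
  set F : Finset Uid := (roots.filterMap Request.src).toFinset with hF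
  have hsrc : ReqSrcsIn F roots' := by
    intro e he u hu
    obtain ⟨e', he', rfl⟩ := List.mem_map.1 he
    rw [hF, List.mem_toFinset, List.mem_filterMap]
    exact ⟨e', he', hu⟩
  have hinit : ApplyInv S j roots.length F
      { pq := roots'.filter fun e => e.leafArc?.isNone
        pushed := roots.length
        file := roots'.filterMap Request.leafArc?
        trace := [.live (base + roots.length)] } := by
    refine ⟨hsrc.leafArcs, hsrc.filter _, ?_, ?_, le_rfl⟩
    · intro u hu
      rw [hF, List.mem_toFinset, List.mem_filterMap] at hu
      obtain ⟨e, he, heu⟩ := hu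
      exact Or.inl (h e he u heu)
    -- Initially `pushed = R`: requests that resolve to terminals are counted too. Their sources
    -- contribute the second `R`.
    · refine Nat.add_le_add ((List.toFinset_card_le _).trans (List.length_filterMap_le _ _)) ?_
      exact (List.length_filter_le _ _).trans (by rw [hroots', List.length_map])
  obtain ⟨F', h'⟩ := hinit.foldl op G base (List.range' (j + 1) (n - (j + 1))) (by
    intro l hl
    have := (List.mem_range'_1.1 hl).1
    omega)
  exact ⟨F', h'.file, h'.pq, h'.origin, h'.card, h'.initial⟩

/-! ## Inner Reduce sweep -/

/-- Throughout an inner Reduce sweep of a file with sources in `F`, all arcs have sources in `F`, and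
those that leave the sweep have no sources below level `j`. -/
structure ReduceInv (F : Finset Uid) (j : ℕ) (st : InnerState) : Prop where
  pq : SrcsIn F st.pq
  toOuter : ∀ a ∈ st.toOuter, ∀ u, a.src = some u → u ∈ F ∧ ¬ j < u.1
  toNext : ∀ e ∈ st.toNext, ∀ u, e.src = some u → u ∈ F ∧ ¬ j < u.1

theorem ReduceInv.distribute {F : Finset Uid} {j : ℕ} {st : InnerState} (h : ReduceInv F j st)
    (next : Option ℕ) {as : List Arc} (has : SrcsIn F as) :
    ReduceInv F j (InnerState.distribute j next st as) := by
  have hout : ∀ a ∈ as.filter (fun a => !isBelow j a.src), ∀ u, a.src = some u →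
      u ∈ F ∧ ¬ j < u.1 := by
    intro a ha u hu
    rw [List.mem_filter] at ha
    exact ⟨has a ha.1 u hu, by simpa [isBelow, hu] using ha.2⟩
  refine ⟨h.pq.append (has.of_subset fun b hb => List.mem_of_mem_filter hb), ?_, ?_⟩
  · intro a ha
    rcases List.mem_append.1 ha with ha | ha
    · exact h.toOuter a ha
    · exact hout a (List.mem_of_mem_filter ha)
  · intro e he
    rcases List.mem_append.1 he with he | he
    · exact h.toNext e he
    · obtain ⟨a, ha, rfl⟩ := List.mem_map.1 he
      exact hout a (List.mem_of_mem_filter ha)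

theorem ReduceInv.step {F : Finset Uid} {j : ℕ} {st : InnerState} (h : ReduceInv F j st)
    {file : List Arc} (hf : SrcsIn F file) (next : Option ℕ) (base l : ℕ) :
    ReduceInv F j (innerReduceLevel file j next base st l) ∧
      (innerReduceLevel file j next base st l).nodes.length
        ≤ st.nodes.length + levelCard F l := by
  constructor
  · have h' : ReduceInv F j
        { st with
          pq := st.pq.filter fun a => !a.from l
          nodes := (reduceLevel file st.pq l).nodes ++ st.nodes } :=
      ⟨h.pq.of_subset fun b hb => List.mem_of_mem_filter hb, h.toOuter, h.toNext⟩
    have h'' := h'.distribute next (srcsIn_fwd_reduceLevel hf st.pq l)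
    exact ⟨h''.pq, h''.toOuter, h''.toNext⟩
  · change ((reduceLevel file st.pq l).nodes ++ st.nodes).length ≤ _
    rw [List.length_append, add_comm]
    exact Nat.add_le_add_left (length_nodes_reduceLevel_le_levelCard hf h.pq l) _

theorem ReduceInv.foldl {F : Finset Uid} {j : ℕ} {file : List Arc} (hf : SrcsIn F file)
    (next : Option ℕ) (base : ℕ) (L : List ℕ) {st : InnerState} (h : ReduceInv F j st) :
    ReduceInv F j (L.foldl (innerReduceLevel file j next base) st) ∧
      (L.foldl (innerReduceLevel file j next base) st).nodes.length
        ≤ st.nodes.length + (L.map (levelCard F)).sum := by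
  induction L generalizing st with
  | nil => exact ⟨h, by simp⟩
  | cons l L ih =>
    obtain ⟨h1, h2⟩ := h.step hf next base l
    obtain ⟨h3, h4⟩ := ih h1
    refine ⟨h3, h4.trans ?_⟩
    rw [List.map_cons, List.sum_cons]
    omega

/-- Reduction never creates sources, so the per-level bounds sum to `F.card`. -/
theorem reduceInv_innerReduce {F : Finset Uid} {file : List Arc} (hf : SrcsIn F file) (n j : ℕ)
    (next : Option ℕ) (base : ℕ) :
    ReduceInv F j (innerReduce n j next base file) ∧
      (innerReduce n j next base file).nodes.length ≤ F.card := by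
  have hinit : ReduceInv F j (InnerState.distribute j next ⟨[], 0, [], [], [], []⟩
      (file.filter fun a => a.toLeaf && !isBelow j a.src)) := by
    refine ReduceInv.distribute ⟨?_, ?_, ?_⟩ next
      (hf.of_subset fun b hb => List.mem_of_mem_filter hb)
    all_goals
      intro a ha
      cases ha
  obtain ⟨h1, h2⟩ := hinit.foldl hf next base (List.range' (j + 1) (n - (j + 1))).reverse
  refine ⟨⟨h1.pq, h1.toOuter, h1.toNext⟩, h2.trans ?_⟩
  have := sum_levelCard_le F (List.nodup_reverse.2 (List.nodup_range' (s := j + 1)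
    (n := n - (j + 1)) (step := 1)))
  exact (Nat.zero_add _).le.trans this

/-! ## Costs of traces -/

/-- A cost measure of events is nonnegative, and handling no elements costs nothing. -/
structure IsCost (g : Event → ℝ) : Prop where
  nonneg : ∀ e, 0 ≤ g e
  scan_zero : g (.scan 0) = 0
  queue_zero : g (.queue 0) = 0

/-- Total cost of a trace. -/
noncomputable def cost (g : Event → ℝ) (tr : List Event) : ℝ := (tr.map g).sum

theorem cost_append (g : Event → ℝ) (tr tr' : List Event) :
    cost g (tr ++ tr') = cost g tr + cost g tr' := by
  simp [cost]

theorem IsCost.cost_nonneg {g : Event → ℝ} (hg : IsCost g) (tr : List Event) : 0 ≤ cost g tr := by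
  refine List.sum_nonneg fun x hx => ?_
  obtain ⟨e, -, rfl⟩ := List.mem_map.1 hx
  exact hg.nonneg e

theorem IsCost.le_cost_of_mem {g : Event → ℝ} (hg : IsCost g) {tr : List Event} {e : Event}
    (he : e ∈ tr) : g e ≤ cost g tr := by
  refine List.single_le_sum (fun x hx => ?_) _ (List.mem_map_of_mem he)
  obtain ⟨e, -, rfl⟩ := List.mem_map.1 hx
  exact hg.nonneg e

theorem isCost_time : IsCost Event.time := by
  have hs : ∀ k : ℕ, 0 ≤ sortTime k := fun k => by
    rcases Nat.eq_zero_or_pos k with rfl | hk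
    · simp [sortTime]
    · exact mul_nonneg (Nat.cast_nonneg _) (Real.logb_nonneg one_lt_two (by exact_mod_cast hk))
  refine ⟨fun e => ?_, by simp [Event.time], by simp [Event.time, sortTime]⟩
  cases e with
  | scan k => exact Nat.cast_nonneg k
  | sort k => exact hs k
  | queue k => exact hs k
  | live k => exact le_rfl

/-- `sortIos` is negative for `0 < k < B`; it is charged only for `k > M ≥ 2B`, where the logarithm
is nonnegative. -/
theorem isCost_ios {M B : ℕ} (hB : 0 < B) (hM : 2 * B ≤ M) : IsCost (Event.ios M B) := by
  have hB' : (0 : ℝ) < B := by exact_mod_cast hB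
  have hM' : (2 : ℝ) * B ≤ M := by exact_mod_cast hM
  have hs : ∀ k : ℕ, 0 ≤ if k ≤ M then (0 : ℝ) else sortIos M B k := fun k => by
    split
    · exact le_rfl
    · rename_i hk
      have hk' : (M : ℝ) ≤ k := by exact_mod_cast (not_le.1 hk).le
      refine mul_nonneg (by positivity) (Real.logb_nonneg ?_ ?_)
      · rw [lt_div_iff₀ hB']
        linarith
      · rw [le_div_iff₀ hB']
        linarith
  refine ⟨fun e => ?_, by simp [Event.ios], by simp [Event.ios]⟩
  cases e with
  | scan k => exact div_nonneg (Nat.cast_nonneg k) hB'.le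
  | sort k => exact hs k
  | queue k => exact hs k
  | live k => exact le_rfl

/-! ## Outer Reduce sweep -/

/-- Throughout the outer Reduce sweep, all sources are in `S`, and up to `a` nodes that have been
added by the outer sweep itself, the reduced nodes are the `t` nodes written by an inner Reduce sweep,
which are at most twice as many as the `k` elements in the priority queue of the inner Apply sweep. -/
structure OuterInv (g : Event → ℝ) (S : Finset Uid) (a : ℕ) (st : OuterState) : Prop where
  pq : SrcsIn S st.pq
  requests : ReqSrcsIn S st.requests
  charged : ∃ k t, st.nodes.length ≤ a + t ∧ t ≤ 2 * k ∧
    g (.queue k) + g (.scan t) ≤ cost g st.trace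

theorem OuterInv.reduceLevel {g : Event → ℝ} (hg : IsCost g) {S : Finset Uid} {a : ℕ}
    {st : OuterState} (h : OuterInv g S a st) (nest : ℕ → Option (Bool → Bool → Bool))
    {file : List Arc} (hf : SrcsIn S file) (l : ℕ) :
    OuterInv g S (a + levelCard S l) (outerReduceLevel nest file st l) := by
  have hfwd := srcsIn_fwd_reduceLevel hf st.pq l
  refine ⟨?_, ?_, ?_⟩
  · exact (h.pq.of_subset fun b hb => List.mem_of_mem_filter hb).append
      (hfwd.of_subset fun b hb => List.mem_of_mem_filter hb)
  · refine h.requests.append ?_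
    intro e he u hu
    obtain ⟨b, hb, rfl⟩ := List.mem_map.1 he
    exact hfwd b (List.mem_of_mem_filter hb) u hu
  · obtain ⟨k, t, h1, h2, h3⟩ := h.charged
    refine ⟨k, t, ?_, h2, ?_⟩
    · change ((NestedSweeping.reduceLevel file st.pq l).nodes ++ st.nodes).length ≤ _
      rw [List.length_append]
      have := length_nodes_reduceLevel_le_levelCard hf h.pq l
      omega
    · refine h3.trans ?_
      simp only [outerReduceLevel, cost_append]
      exact le_add_of_nonneg_right (hg.cost_nonneg _)

/-- The witnesses `k` and `t` are chosen afresh, since earlier reduced nodes are discarded. -/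
theorem OuterInv.innerSweeps {g : Event → ℝ} (hg : IsCost g) {S : Finset Uid} {a : ℕ}
    {st : OuterState} (h : OuterInv g S a st) (n : ℕ) (nest : ℕ → Option (Bool → Bool → Bool))
    (op : Bool → Bool → Bool) (file : List Arc) (j : ℕ) :
    OuterInv g S a (innerSweeps n nest op file j st) := by
  set base := file.length + st.pq.length + st.nodes.length with hbase
  obtain ⟨F, hF⟩ := applyInv_innerApply h.requests n j op st.nodes base
  set ap := innerApply n j op st.nodes base st.requests with hap
  obtain ⟨hre, hlen⟩ := reduceInv_innerReduce hF.file n j (nextNested nest j) base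
  set re := innerReduce n j (nextNested nest j) base ap.file with hre'
  refine ⟨h.pq.append ?_, ?_, ap.pushed, re.nodes.length, ?_, ?_, ?_⟩
  · intro b hb u hu
    -- New nodes lie below level `j`, but arcs leaving the sweep do not start there; so their
    -- sources are old ones, in `S`.
    obtain ⟨h1, h2⟩ := hre.toOuter b hb u hu
    exact (hF.origin u h1).resolve_right h2
  · intro e he u hu
    obtain ⟨h1, h2⟩ := hre.toNext e he u hu
    exact (hF.origin u h1).resolve_right h2
  · exact Nat.le_add_left _ _
  -- `t ≤ F.card ≤ pushed + R ≤ 2 * pushed`.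
  · have := hF.card
    have := hF.initial
    omega
  · have hq : Event.queue ap.pushed ∈ ap.trace := by simp [hap, innerApply]
    have hs : Event.scan re.nodes.length ∈ re.trace := by simp [hre', innerReduce]
    change _ ≤ cost g (st.trace ++ ap.trace ++ re.trace)
    rw [cost_append, cost_append]
    have := hg.cost_nonneg st.trace
    have := hg.le_cost_of_mem hq
    have := hg.le_cost_of_mem hs
    linarith

theorem OuterInv.step {g : Event → ℝ} (hg : IsCost g) {S : Finset Uid} {a : ℕ} {st : OuterState}
    (h : OuterInv g S a st) (n : ℕ) (nest : ℕ → Option (Bool → Bool → Bool)) {file : List Arc}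
    (hf : SrcsIn S file) (l : ℕ) : OuterInv g S (a + levelCard S l) (outerStep n nest file st l) := by
  have h' := h.reduceLevel hg nest hf l
  unfold outerStep
  split
  · exact h'.innerSweeps hg n nest _ file l
  · exact h'

theorem OuterInv.foldl {g : Event → ℝ} (hg : IsCost g) {S : Finset Uid} (n : ℕ)
    (nest : ℕ → Option (Bool → Bool → Bool)) {file : List Arc} (hf : SrcsIn S file) (L : List ℕ)
    {a : ℕ} {st : OuterState} (h : OuterInv g S a st) :
    OuterInv g S (a + (L.map (levelCard S)).sum) (L.foldl (outerStep n nest file) st) := by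
  induction L generalizing a st with
  | nil => exact h
  | cons l L ih =>
    have := ih (h.step hg n nest hf l)
    rwa [add_assoc, ← List.sum_cons, ← List.map_cons] at this

/-! ## Nested sweeping -/

theorem length_outerApply (f : Bdd) : (outerApply f).length = 2 * f.size + 1 := by
  simp [outerApply, length_sortOn, Bdd.size, List.length_flatMap, mul_comm]

/-- The output of nested sweeping is paid for by the outer Apply sweep and by the last inner
sweeps. -/
theorem exists_charge_nestedSweep {g : Event → ℝ} (hg : IsCost g) (n : ℕ)
    (nest : ℕ → Option (Bool → Bool → Bool)) (f : Bdd) :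
    ∃ k t, (nestedSweep n nest f).output.size ≤ 2 * f.size + 1 + t ∧ t ≤ 2 * k ∧
      g (.scan f.size) + g (.sort (2 * f.size + 1)) + g (.scan (2 * f.size + 1)) + g (.queue k)
        + g (.scan t) ≤ cost g (nestedSweep n nest f).trace := by
  have hinit : OuterInv g (srcSet (outerApply f)) 0 ⟨[], 0, [], [], []⟩ := by
    -- `k = t = 0` remains the charge if no level is nested.
    refine ⟨?_, ?_, 0, 0, le_rfl, le_rfl, ?_⟩
    · intro a ha
      cases ha
    · intro a ha
      cases ha
    · simp [cost, hg.scan_zero, hg.queue_zero]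
  have h := hinit.foldl hg n nest (srcsIn_srcSet _) (List.range n).reverse
  obtain ⟨k, t, h1, h2, h3⟩ := h.charged
  refine ⟨k, t, h1.trans ?_, h2, ?_⟩
  · have h4 := sum_levelCard_le (srcSet (outerApply f))
      (List.nodup_reverse.2 (List.nodup_range (n := n)))
    have h5 := card_srcSet_le (outerApply f)
    rw [length_outerApply] at h5
    omega
  · simp only [nestedSweep, cost_append]
    have h4 : cost g (outerApplyTrace f) = g (.scan f.size) + g (.sort (2 * f.size + 1))
        + g (.scan (2 * f.size + 1)) + g (.live (2 * f.size + 1)) := by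
      simp [cost, outerApplyTrace, length_outerApply, add_assoc]
    rw [h4]
    have := hg.nonneg (.live (2 * f.size + 1))
    refine le_add_of_le_of_nonneg ?_ (hg.cost_nonneg _)
    linarith

theorem size_add_size_le_space (n : ℕ) (nest : ℕ → Option (Bool → Bool → Bool)) (f : Bdd) :
    f.size + (nestedSweep n nest f).output.size ≤ space (nestedSweep n nest f).trace := by
  have hmem : Event.live ((outerApply f).length + (nestedSweep n nest f).output.size)
      ∈ (nestedSweep n nest f).trace := by
    simp [nestedSweep, Bdd.size]
  have hle : ∀ (tr : List Event) (e : Event), e ∈ tr → e.space ≤ space tr := by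
    intro tr
    induction tr with
    | nil => simp
    | cons e' tr ih =>
      intro e he
      rcases List.mem_cons.1 he with rfl | he
      · exact le_max_left _ _
      · exact (ih e he).trans (le_max_right _ _)
  have := hle _ _ hmem
  rw [length_outerApply] at this
  simp only [Event.space] at this
  omega

/-! ## Estimates for `sort` -/

/-- Logarithms to a base of at least two grow by at most two if the argument grows by the factor
four. -/
theorem mul_logb_le {b x y : ℝ} (hb : 2 ≤ b) (hx : 0 ≤ x) (hxy : x ≤ 4 * y) :
    x * Real.logb b x ≤ x * (2 + Real.logb b y) := by
  have hb1 : 1 < b := by linarith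
  rcases hx.eq_or_lt with rfl | hx
  · simp
  have hy : 0 < y := by linarith
  -- This is `4 ≤ b ^ 2`.
  have h4 : Real.logb b 4 ≤ 2 := by
    rw [Real.logb_le_iff_le_rpow hb1 (by norm_num), Real.rpow_two]
    nlinarith
  refine mul_le_mul_of_nonneg_left ?_ hx.le
  calc Real.logb b x ≤ Real.logb b (4 * y) := Real.logb_le_logb_of_le hb1 hx hxy
    _ = Real.logb b 4 + Real.logb b y := Real.logb_mul (by norm_num) hy.ne'
    _ ≤ 2 + Real.logb b y := by linarith

/-- `1 ≤ y` makes `Real.logb b y` nonnegative, so that the factor `x` in front of it can be replaced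
by `4 * y`. -/
theorem mul_logb_le_add {b x y : ℝ} (hb : 2 ≤ b) (hx : 0 ≤ x) (hy : 1 ≤ y) (hxy : x ≤ 4 * y) :
    x * Real.logb b x ≤ 4 * (y * Real.logb b y) + 2 * x := by
  have h1 := mul_logb_le hb hx hxy
  have h2 := mul_le_mul_of_nonneg_right hxy (Real.logb_nonneg (by linarith : 1 < b) hy)
  linarith

theorem sortTime_le {K m : ℕ} (hm : 1 ≤ m) (h : K ≤ 4 * m) :
    sortTime K ≤ 4 * sortTime m + 2 * K :=
  mul_logb_le_add le_rfl (Nat.cast_nonneg K) (by exact_mod_cast hm) (by exact_mod_cast h)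

theorem sortIos_le {M B : ℕ} (hB : 0 < B) (hM : 2 * B ≤ M) {K m : ℕ} (h : K ≤ 4 * m) :
    sortIos M B K ≤ 4 * (Event.sort m).ios M B + 3 * (K / B) := by
  have hB' : (0 : ℝ) < B := by exact_mod_cast hB
  have hM' : (2 : ℝ) * B ≤ M := by exact_mod_cast hM
  have hb : (2 : ℝ) ≤ M / B := by rwa [le_div_iff₀ hB']
  have hK : (0 : ℝ) ≤ K / B := by positivity
  have hle : ∀ m' : ℕ, K ≤ 4 * m' → (K : ℝ) / B ≤ 4 * ((m' : ℝ) / B) := by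
    intro m' hm'
    rw [← mul_div_assoc]
    exact div_le_div_of_nonneg_right (by exact_mod_cast hm') hB'.le
  change sortIos M B K ≤ 4 * (if m ≤ M then 0 else sortIos M B m) + _
  unfold sortIos
  split
  · rename_i hm
    -- Sorting `m ≤ M` elements is free, but then `K ≤ 4 * M` and the logarithm is at most `2 + 1`;
    -- this is the origin of the 3.
    have h1 := mul_logb_le hb hK (hle M (by omega))
    rw [Real.logb_self_eq_one (by linarith)] at h1
    linarith
  · rename_i hm
    have hm' : (M : ℝ) ≤ m := by exact_mod_cast (not_le.1 hm).le
    have h1 := mul_logb_le_add hb hK (y := (m : ℝ) / B)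
      (by rw [le_div_iff₀ hB']; linarith) (hle m h)
    linarith

/-- The charges for the outer Apply sweep and for the last inner sweeps dominate the cost of sorting
the input and the output. -/
theorem sort_le_cost_nestedSweep {g : Event → ℝ} (hg : IsCost g)
    (hq : ∀ k, g (.queue k) = g (.sort k)) {q : ℝ} (hs : ∀ k : ℕ, g (.scan k) = k * q)
    {s : ℕ → ℝ} (hsort : ∀ K m : ℕ, 1 ≤ m → K ≤ 4 * m → s K ≤ 4 * g (.sort m) + 3 * (K * q))
    (n : ℕ) (nest : ℕ → Option (Bool → Bool → Bool)) (f : Bdd) :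
    s (f.size + (nestedSweep n nest f).output.size)
      ≤ 4 * cost g (nestedSweep n nest f).trace := by
  obtain ⟨k, t, h1, h2, h3⟩ := exists_charge_nestedSweep hg n nest f
  set K := f.size + (nestedSweep n nest f).output.size with hK
  have hmax : g (.sort (max (2 * f.size + 1) k)) ≤ g (.sort (2 * f.size + 1)) + g (.queue k) := by
    have ha := hg.nonneg (.sort (2 * f.size + 1))
    have hb := hg.nonneg (.queue k)
    rcases max_choice (2 * f.size + 1) k with h | h
    · rw [h]
      linarith
    · rw [h, ← hq]
      linarith
  have hscan : (K : ℝ) * q ≤ g (.scan f.size) + g (.scan (2 * f.size + 1)) + g (.scan t) := by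
    have hq0 : 0 ≤ q := by simpa [hs] using hg.nonneg (.scan 1)
    have hle : (K : ℝ) ≤ f.size + (2 * f.size + 1 : ℕ) + t := by
      -- The three scans cover all of `N + T`, as `T ≤ 2N + 1 + t`.
      have : K ≤ f.size + (2 * f.size + 1) + t := by omega
      exact_mod_cast this
    rw [hs, hs, hs, ← add_mul, ← add_mul]
    exact mul_le_mul_of_nonneg_right hle hq0
  have hKq : 0 ≤ (K : ℝ) * q := by simpa [hs] using hg.nonneg (.scan K)
  -- `K ≤ (3N + 1) + 2k`, and each of the two summands is at most twice the maximum.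
  have := hsort K (max (2 * f.size + 1) k) (by omega) (by omega)
  linarith

end NestedSweeping

theorem mainTheorem4 :
    ∃ c : ℝ, 0 < c ∧
      ∀ (M B : ℕ), 0 < B → 2 * B ≤ M →
      ∀ (n : ℕ) (nest : ℕ → Option (Bool → Bool → Bool)) (f : NestedSweeping.Bdd),
        f.IsROBDD n →
        ∀ (r : NestedSweeping.Run), r = NestedSweeping.nestedSweep n nest f →
        ∀ (N T : ℕ), N = f.size → T = r.output.size →
          c * ((N + T : ℕ) : ℝ) ≤ (NestedSweeping.space r.trace : ℝ) ∧
          c * NestedSweeping.sortTime (N + T) ≤ NestedSweeping.time r.trace ∧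
          c * NestedSweeping.sortIos M B (N + T) ≤ NestedSweeping.ios M B r.trace := by
  -- The 4 comes from `N + T ≤ 4m`; for space, constant 1 would do.
  refine ⟨1 / 4, by norm_num, ?_⟩
  rintro M B hB hM n nest f - r rfl N T rfl rfl
  refine ⟨?_, ?_, ?_⟩
  · have h1 : ((f.size + (NestedSweeping.nestedSweep n nest f).output.size : ℕ) : ℝ)
        ≤ NestedSweeping.space (NestedSweeping.nestedSweep n nest f).trace := by
      exact_mod_cast NestedSweeping.size_add_size_le_space n nest f
    have h2 : (0 : ℝ) ≤ (f.size + (NestedSweeping.nestedSweep n nest f).output.size : ℕ) :=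
      Nat.cast_nonneg _
    linarith
  · have := NestedSweeping.sort_le_cost_nestedSweep NestedSweeping.isCost_time (fun _ => rfl)
      (q := 1) (fun k => (mul_one (k : ℝ)).symm) (s := NestedSweeping.sortTime)
      (fun K m hm h => (NestedSweeping.sortTime_le hm h).trans (by
        have : (0 : ℝ) ≤ K := Nat.cast_nonneg K
        simp only [NestedSweeping.Event.time]
        linarith)) n nest f
    change _ ≤ NestedSweeping.cost _ _
    linarith
  · have := NestedSweeping.sort_le_cost_nestedSweep (NestedSweeping.isCost_ios hB hM)
      (fun _ => rfl) (q := (B : ℝ)⁻¹) (fun k => div_eq_mul_inv (k : ℝ) B)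
      (s := NestedSweeping.sortIos M B)
      (fun K m _ h => by
        rw [← div_eq_mul_inv]
        exact NestedSweeping.sortIos_le hB hM h) n nest f
    change _ ≤ NestedSweeping.cost _ _
    linarith
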